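/- Let $F$ be a field of characteristic $0$, let $F(t)$ be the field of rational functions over $F$ in one variable $t$, and let $n \ge 1$ be an integer. Put $$f(X,t) = X(X-t)^{n-1} + t \in F(t)[X].$$ Then the splitting field of $f(X,t)$ over $F(t)$ is an $S_n$-extension of $F(t)$; that is, it is a Galois extension of $F(t)$ whose Galois group is isomorphic to the symmetric group $S_n$ on $n$ letters. -/

import Mathlib

open Polynomial

/-- The polynomial `f(X, t) = X (X - t)^(n-1) + t`, as a polynomial in `X` over the rational
function field `F(t)`, where `t` is `RatFunc.X`. It is meant for `1 ≤ n`. -/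
noncomputable def familyPoly (F : Type*) [Field F] (n : ℕ) : (RatFunc F)[X] :=
  X * (X - C (RatFunc.X : RatFunc F)) ^ (n - 1) + C (RatFunc.X : RatFunc F)

/-- `L / K` is an `S_n`-extension: it is Galois and its Galois group is isomorphic to the symmetric
group on `n` letters. -/
def IsSymmetricExtension (n : ℕ) (K L : Type*) [Field K] [Field L] [Algebra K L] : Prop :=
  IsGalois K L ∧ Nonempty ((L ≃ₐ[K] L) ≃* Equiv.Perm (Fin n))

/-!
Write `t` for the variable of `F(t)`, `f = X (X - t) ^ (n - 1) + t` and `G` for the Galois group,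
acting on the roots of `f`. The action is faithful, so it is enough that its image is the whole
symmetric group. For `n ≥ 2` this follows from Jordan's theorem: a primitive permutation group that
contains a transposition is the full symmetric group.

*Primitivity.* The action is even doubly transitive. It is transitive because `f` is Eisenstein
at `t` (`irreducible_familyPoly`). For the stabilizer of a root `c`, put `Z = c - t`. The equation
of `c` reads `t (Z ^ (n - 1) + 1) = - Z ^ n`, so `F(t)(c) = F(Z)` is again a rational function
field. If `z` is another root and `Y = Z / (z - t)`, eliminating `t` between the equations of `c`
and `z` and dividing by `Y - 1` leaves `1 + Y + ⋯ + Y ^ (n - 1) + Z ^ (n - 1) = 0`. That polynomial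
in `Y` is irreducible over `F(Z)`: as a polynomial in `Z` it is Eisenstein at any prime factor of
the squarefree polynomial `1 + Y + ⋯ + Y ^ (n - 1)` (`irreducible_geom_sum_add_C_X_pow`). Hence the
stabilizer of `c` permutes the other roots transitively
(`exists_algEquiv_fix_root_map_root`).

*A transposition.* Over an algebraic closure `K` of `F` pick `t₀ ≠ 0` at which `f` has a multiple
root `a`; then `a = t₀ / n` is a double root and all other roots are simple. Embed `F(t)` in
`K((x))` by `t ↦ t₀ + x`. By Hensel's lemma the simple roots lift to `K[[x]]`, so at most two roots
of `f` in an algebraic closure of `K((x))` are not in `K((x))`. They cannot all be in `K((x))`,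
since then a root in `K[[x]]` would reduce to `a`, which is impossible because `f(a)` has a nonzero
linear term in `x` (`constantCoeff_ne_of_isRoot`). So some automorphism over `K((x))` moves a root
and moves at most two (`exists_galois_moving_two_roots`); its restriction to the splitting field
acts as a transposition.
-/

open Polynomial
open scoped PowerSeries LaurentSeries

/-! ### Two irreducible polynomials -/

/-- Read as a polynomial in `T`, the polynomial `1 + Y + ⋯ + Y ^ (n - 1) + T ^ (n - 1)` is Eisenstein
at a prime factor of `1 + Y + ⋯ + Y ^ (n - 1)`, which is squarefree in characteristic zero. -/
theorem irreducible_geom_sum_add_C_X_pow (F : Type*) [Field F] [CharZero F] {n : ℕ} (hn : 2 ≤ n) :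
    Irreducible (∑ i ∈ Finset.range n, X ^ i + C ((RatFunc.X : RatFunc F) ^ (n - 1))) := by
  set φ : F[X] := ∑ i ∈ Finset.range n, X ^ i with hφ
  have hmul : φ * (X - 1) = X ^ n - 1 := geom_sum_mul X n
  have hsq : Squarefree φ := by
    refine Squarefree.squarefree_of_dvd ⟨X - 1, hmul.symm⟩ ?_
    exact (X_pow_sub_one_separable_iff.2 (by simp; omega)).squarefree
  have hdeg : φ.natDegree = n - 1 := by
    have h := congrArg natDegree hmul
    rw [← C_1, natDegree_mul (hsq.ne_zero) (X_sub_C_ne_zero 1), natDegree_X_sub_C,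
      natDegree_X_pow_sub_C] at h
    omega
  obtain ⟨q, hq, hqφ⟩ := WfDvdMonoid.exists_irreducible_factor
    (a := φ) (fun h ↦ by have := natDegree_eq_zero_of_isUnit h; omega) hsq.ne_zero
  -- Eisenstein's criterion at `q` for the polynomial read in the other variable.
  have hE : Irreducible (X ^ (n - 1) + C φ) := by
    have hmon : (X ^ (n - 1) + C φ).Monic := monic_X_pow_add_C φ (by omega)
    refine irreducible_of_eisenstein_criterion (P := Ideal.span {q})
      ((Ideal.span_singleton_prime hq.ne_zero).2 hq.prime) ?_ ?_ ?_ ?_ hmon.isPrimitive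
    · rw [hmon.leadingCoeff, Ideal.mem_span_singleton]
      exact fun h ↦ hq.not_isUnit (isUnit_of_dvd_one h)
    · intro m hm
      rw [degree_X_pow_add_C (by omega), Nat.cast_lt] at hm
      rw [coeff_add, coeff_X_pow, if_neg hm.ne, zero_add, coeff_C, Ideal.mem_span_singleton]
      split_ifs <;> simp [hqφ]
    · rw [degree_X_pow_add_C (by omega)]
      exact_mod_cast (by omega : 0 < n - 1)
    · rw [Ideal.span_singleton_pow, Ideal.mem_span_singleton, coeff_add, coeff_X_pow,
        if_neg (by omega), zero_add, coeff_C_zero, pow_two]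
      exact fun h ↦ hq.not_isUnit (hsq q h)
  have hE' : Irreducible (φ.map C + C (X ^ (n - 1)) : F[X][X]) := by
    have := (MulEquiv.irreducible_iff (Bivariate.swap (R := F))).2 hE
    rwa [map_add, map_pow, Bivariate.swap_Y, Bivariate.swap_C, ← C_pow, add_comm] at this
  have hmonic : (φ.map C + C (X ^ (n - 1)) : F[X][X]).Monic := by
    have hφm : φ.Monic := by
      refine Monic.of_mul_monic_right (q := X - 1) ?_ ?_
      · exact monic_X_sub_C 1
      · rw [hmul]; exact monic_X_pow_sub_C 1 (by omega)
    refine (hφm.map C).add_of_left ?_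
    refine degree_C_le.trans_lt ?_
    rw [hφm.degree_map, ← natDegree_pos_iff_degree_pos]
    omega
  have := (hmonic.irreducible_iff_irreducible_map_fraction_map (K := RatFunc F)).1 hE'
  convert this using 1
  simp [hφ, Polynomial.map_sum, RatFunc.algebraMap_X]

/-- The polynomial `X (X - t) ^ (n - 1) + t` over `F[t]`, where `t` is the inner variable. -/
noncomputable def integralFamily (F : Type*) [Field F] (n : ℕ) : F[X][X] :=
  X * (X - C X) ^ (n - 1) + C X

section

variable (F : Type*) [Field F] {n : ℕ}

theorem map_integralFamily {R : Type*} [CommRing R] (g : F[X] →+* R) :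
    (integralFamily F n).map g = X * (X - C (g X)) ^ (n - 1) + C (g X) := by
  simp [integralFamily]

theorem map_algebraMap_integralFamily :
    (integralFamily F n).map (algebraMap F[X] (RatFunc F)) = familyPoly F n := by
  simp [map_integralFamily, familyPoly, RatFunc.algebraMap_X]

theorem natDegree_X_mul_X_sub_C_pow {R : Type*} [CommRing R] [Nontrivial R] (hn : 1 ≤ n) (t : R) :
    (X * (X - C t) ^ (n - 1)).natDegree = n := by
  rw [monic_X.natDegree_mul ((monic_X_sub_C t).pow _), (monic_X_sub_C t).natDegree_pow,
    natDegree_X, natDegree_X_sub_C]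
  omega

theorem monic_X_mul_X_sub_C_pow_add_C {R : Type*} [CommRing R] [Nontrivial R]
    (hn : 1 ≤ n) (t : R) : (X * (X - C t) ^ (n - 1) + C t).Monic := by
  have hm : (X * (X - C t) ^ (n - 1)).Monic := monic_X.mul ((monic_X_sub_C t).pow _)
  refine hm.add_of_left (degree_C_le.trans_lt ?_)
  rw [← natDegree_pos_iff_degree_pos, natDegree_X_mul_X_sub_C_pow hn]
  omega

theorem natDegree_X_mul_X_sub_C_pow_add_C {R : Type*} [CommRing R] [Nontrivial R] (hn : 1 ≤ n)
    (t : R) : (X * (X - C t) ^ (n - 1) + C t).natDegree = n := by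
  rw [natDegree_add_C, natDegree_X_mul_X_sub_C_pow hn]

/-- `X (X - t) ^ (n - 1) + t` is Eisenstein at `t`, since it reduces to `X ^ n`. -/
theorem irreducible_familyPoly (hn : 1 ≤ n) : Irreducible (familyPoly F n) := by
  have hmon : (integralFamily F n).Monic := monic_X_mul_X_sub_C_pow_add_C hn X
  have hdeg : (integralFamily F n).natDegree = n := natDegree_X_mul_X_sub_C_pow_add_C hn X
  rw [← map_algebraMap_integralFamily, ← hmon.irreducible_iff_irreducible_map_fraction_map]
  have hX : Prime (X : F[X]) := prime_X
  have hpos : 0 < (integralFamily F n).natDegree := by omega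
  refine irreducible_of_eisenstein_criterion (P := Ideal.span {X})
    ((Ideal.span_singleton_prime hX.ne_zero).2 hX) ?_ ?_ (natDegree_pos_iff_degree_pos.1 hpos) ?_
    hmon.isPrimitive
  · rw [hmon.leadingCoeff, Ideal.mem_span_singleton]
    exact fun h ↦ hX.not_isUnit (isUnit_of_dvd_one h)
  · intro m hm
    rw [degree_eq_natDegree hmon.ne_zero, hdeg, Nat.cast_lt] at hm
    have h : (integralFamily F n).map constantCoeff = X ^ n := by
      rw [map_integralFamily]
      simp [← pow_succ', Nat.sub_add_cancel hn]
    rw [Ideal.mem_span_singleton, X_dvd_iff, ← constantCoeff_apply, ← coeff_map, h, coeff_X_pow,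
      if_neg hm.ne]
  · rw [Ideal.span_singleton_pow, Ideal.mem_span_singleton, integralFamily, coeff_add,
      coeff_C_zero, mul_coeff_zero, coeff_X_zero, zero_mul, zero_add, pow_two]
    intro h
    exact hX.irreducible.not_isUnit (hX.irreducible.squarefree X h)

end

/-! ### Double transitivity -/

theorem exists_algEquiv_of_irreducible {k L : Type*} [Field k] [Field L] [Algebra k L] [Normal k L]
    {p : k[X]} (hp : Irreducible p) {x y : L} (hx : aeval x p = 0) (hy : aeval y p = 0) :
    ∃ σ : Gal(L/k), σ x = y := by
  obtain ⟨σ, hσ⟩ := (Normal.minpoly_eq_iff_mem_orbit (F := k) (x := y) (y := x)).1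
    ((minpoly.eq_of_irreducible hp hy).symm.trans (minpoly.eq_of_irreducible hp hx))
  exact ⟨σ, hσ⟩

/-- Roots in `L` of a polynomial that is irreducible over the subfield `j(R)` are conjugate under an
automorphism fixing that subfield. Keeping `R` abstract lets the rational function field `F(Z)` play
its role, embedded differently from the base field `k = F(t)`. -/
theorem exists_algEquiv_of_irreducible_of_range_le {k R L : Type*} [Field k] [Field R] [Field L]
    [Algebra k L] [Normal k L] (j : R →+* L) (hj : (algebraMap k L).range ≤ j.range)
    {p : R[X]} (hp : Irreducible p) {x y : L} (hx : p.eval₂ j x = 0) (hy : p.eval₂ j y = 0) :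
    ∃ σ : Gal(L/k), σ x = y ∧ ∀ r, σ (j r) = j r := by
  let e : R ≃+* j.range := RingEquiv.ofBijective j.rangeRestrict
    ⟨(RingHom.injective j.rangeRestrict), j.rangeRestrict_surjective⟩
  let i : k →+* R := (e.symm : j.range →+* R).comp
    ((algebraMap k L).codRestrict j.range fun a ↦ hj ⟨a, rfl⟩)
  have hij (a : k) : j (i a) = algebraMap k L a :=
    congrArg Subtype.val (e.apply_symm_apply ⟨algebraMap k L a, hj ⟨a, rfl⟩⟩)
  let := i.toAlgebra
  let := j.toAlgebra
  have : IsScalarTower k R L := IsScalarTower.of_algebraMap_eq fun a ↦ (hij a).symm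
  have : Normal R L := Normal.tower_top_of_normal k R L
  obtain ⟨σ, hσ⟩ := exists_algEquiv_of_irreducible hp (L := L) hx hy
  exact ⟨σ.restrictScalars k, hσ, fun r ↦ σ.commutes r⟩

/-- The stabilizer of a root `c` acts transitively on the other roots. -/
theorem exists_algEquiv_fix_root_map_root {F : Type*} [Field F] [CharZero F] {n : ℕ} (hn : 2 ≤ n)
    {L : Type*} [Field L] [Algebra (RatFunc F) L] [Normal (RatFunc F) L] {c x y : L}
    (hc : aeval c (familyPoly F n) = 0) (hx : aeval x (familyPoly F n) = 0)
    (hy : aeval y (familyPoly F n) = 0) (hxc : x ≠ c) (hyc : y ≠ c) :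
    ∃ σ : Gal(L/RatFunc F), σ c = c ∧ σ x = y := by
  let : Algebra F L := ((algebraMap (RatFunc F) L).comp (algebraMap F (RatFunc F))).toAlgebra
  have : IsScalarTower F (RatFunc F) L := IsScalarTower.of_algebraMap_eq fun _ ↦ rfl
  set t : L := algebraMap (RatFunc F) L RatFunc.X with ht
  have ht0 : t ≠ 0 := by simp [ht, RatFunc.X_ne_zero]
  have htr : Transcendental F t :=
    (transcendental_algebraMap_iff (algebraMap (RatFunc F) L).injective).2 RatFunc.transcendental_X
  have key {z : L} (hz : aeval z (familyPoly F n) = 0) :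
      z - t ≠ 0 ∧ t * ((z - t) ^ (n - 1) + 1) = - (z - t) ^ n := by
    have h : z * (z - t) ^ (n - 1) + t = 0 := by simpa [familyPoly, ← ht] using hz
    refine ⟨fun h0 ↦ ht0 ?_, ?_⟩
    · rw [h0, zero_pow (by omega)] at h
      simpa using h
    · have : (z - t) ^ n = (z - t) ^ (n - 1) * (z - t) := by
        rw [← pow_succ, Nat.sub_add_cancel (by omega)]
      rw [this]
      linear_combination h
  obtain ⟨hZ0, hZ⟩ := key hc
  set Z : L := c - t with hZdef
  have hden : Z ^ (n - 1) + 1 ≠ 0 := fun h0 ↦ by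
    rw [h0, mul_zero, eq_comm, neg_eq_zero] at hZ
    exact hZ0 (pow_eq_zero_iff (by omega) |>.1 hZ)
  have htZ : t = - Z ^ n / (Z ^ (n - 1) + 1) := by rw [eq_div_iff hden, hZ]
  -- `t` is algebraic over `F(Z)`, so `Z` is transcendental and `F(Z)` is a copy of `RatFunc F`.
  have hZtr : Transcendental F Z := fun hal ↦ htr <| by
    rw [htZ, div_eq_mul_inv]
    exact (hal.pow n).neg.mul ((hal.pow _).add isAlgebraic_one).inv
  let j : RatFunc F →+* L := IsFractionRing.lift (A := F[X]) (g := (aeval Z).toRingHom)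
    (transcendental_iff_injective.1 hZtr)
  have hj (q : F[X]) : j (algebraMap _ _ q) = aeval Z q := IsFractionRing.lift_algebraMap _ q
  have hjX : j RatFunc.X = Z := by rw [← RatFunc.algebraMap_X, hj, aeval_X]
  have htj : t ∈ j.fieldRange := by
    rw [htZ]
    have : Z ∈ j.fieldRange := ⟨_, hjX⟩
    exact div_mem (neg_mem (pow_mem this _)) (add_mem (pow_mem this _) (one_mem _))
  have hrange : (algebraMap (RatFunc F) L).range ≤ j.range := by
    have hpoly (q : F[X]) : algebraMap (RatFunc F) L (algebraMap _ _ q) ∈ j.fieldRange := by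
      induction q using Polynomial.induction_on' with
      | add p q hp hq => rw [map_add, map_add]; exact add_mem hp hq
      | monomial m a =>
        rw [← C_mul_X_pow_eq_monomial, map_mul, map_mul, map_pow, map_pow, RatFunc.algebraMap_X]
        refine mul_mem ⟨algebraMap F[X] _ (C a), ?_⟩ (pow_mem htj m)
        rw [hj, aeval_C]
        rfl
    rintro _ ⟨r, rfl⟩
    rw [← RatFunc.num_div_denom r, map_div₀]
    exact (div_mem (hpoly _) (hpoly _) : _ ∈ j.fieldRange)
  -- The relation between two roots after dividing by `Z / (z - t) - 1`.
  have hroot {z : L} (hz : aeval z (familyPoly F n) = 0) (hzc : z ≠ c) :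
      (∑ i ∈ Finset.range n, X ^ i + C ((RatFunc.X : RatFunc F) ^ (n - 1))).eval₂ j
        (Z / (z - t)) = 0 := by
    obtain ⟨hW0, hW⟩ := key hz
    have hWZ : z - t ≠ Z := fun h ↦ hzc (sub_left_injective h)
    set W := z - t
    rw [eval₂_add, eval₂_finsetSum, eval₂_C, map_pow, hjX]
    simp_rw [eval₂_X_pow]
    have h1 : Z / W - 1 ≠ 0 := fun h ↦ hWZ (((div_eq_one_iff_eq hW0).1 (sub_eq_zero.1 h)).symm)
    refine (mul_eq_zero_iff_right h1).1 ?_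
    rw [add_mul, geom_sum_mul]
    have h2 : Z ^ n * (W ^ (n - 1) + 1) = W ^ n * (Z ^ (n - 1) + 1) := by
      refine mul_left_cancel₀ ht0 ?_
      linear_combination Z ^ n * hW - W ^ n * hZ
    have e1 : W ^ n = W ^ (n - 1) * W := by rw [← pow_succ, Nat.sub_add_cancel (by omega)]
    have e2 : Z ^ n = Z ^ (n - 1) * Z := by rw [← pow_succ, Nat.sub_add_cancel (by omega)]
    rw [div_pow]
    rw [e1, e2] at h2 ⊢
    have hWp : W ^ (n - 1) ≠ 0 := pow_ne_zero _ hW0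
    field_simp
    linear_combination h2
  obtain ⟨σ, hσ, hσj⟩ := exists_algEquiv_of_irreducible_of_range_le j hrange
    (irreducible_geom_sum_add_C_X_pow F hn) (hroot hx hxc) (hroot hy hyc)
  have hσZ : σ Z = Z := by rw [← hjX, hσj]
  have hσt : σ t = t := σ.commutes _
  have hZt : c = Z + t := by rw [hZdef]; ring
  refine ⟨σ, by rw [hZt, map_add, hσZ, hσt], ?_⟩
  rw [map_div₀, hσZ, map_sub, hσt, div_eq_mul_inv, div_eq_mul_inv] at hσ
  exact sub_left_injective (inv_injective (mul_left_cancel₀ hZ0 hσ))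

theorem isMultiplyPretransitive_two_rootSet {F : Type*} [Field F] [CharZero F] {n : ℕ} (hn : 2 ≤ n)
    {L : Type*} [Field L] [Algebra (RatFunc F) L] [Normal (RatFunc F) L] :
    MulAction.IsMultiplyPretransitive Gal(L/RatFunc F) ((familyPoly F n).rootSet L) 2 := by
  rw [MulAction.is_two_pretransitive_iff]
  rintro ⟨a, ha⟩ ⟨b, hb⟩ ⟨c, hc⟩ ⟨d, hd⟩ hab hcd
  obtain ⟨σ, hσ⟩ := exists_algEquiv_of_irreducible (irreducible_familyPoly F (by omega : 1 ≤ n))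
    (aeval_eq_zero_of_mem_rootSet ha) (aeval_eq_zero_of_mem_rootSet hc)
  obtain ⟨τ, hτc, hτ⟩ := exists_algEquiv_fix_root_map_root hn (aeval_eq_zero_of_mem_rootSet hc)
    (x := σ b) (y := d)
    (by rw [aeval_algEquiv, AlgHom.comp_apply]; simp [aeval_eq_zero_of_mem_rootSet hb])
    (aeval_eq_zero_of_mem_rootSet hd)
    (fun h ↦ hab (Subtype.ext (σ.injective (hσ.trans h.symm))))
    (fun h ↦ hcd (Subtype.ext h.symm))
  refine ⟨τ * σ, Subtype.ext ?_, Subtype.ext ?_⟩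
  · simp [hσ, hτc]
  · simp [hτ]

/-! ### Galois action near a double root -/

theorem constantCoeff_eval_C {K : Type*} [CommRing K] (p : K⟦X⟧[X]) (b : K) :
    PowerSeries.constantCoeff (p.eval (PowerSeries.C b)) =
      (p.map PowerSeries.constantCoeff).eval b := by
  rw [← eval_map_apply, PowerSeries.constantCoeff_C]

/-- Hensel's lemma over `K⟦X⟧`. -/
theorem exists_isRoot_of_simple_root {K : Type*} [Field K] {p : K⟦X⟧[X]} (hp : p.Monic)
    {b : K}
    (hb : (p.map PowerSeries.constantCoeff).IsRoot b)
    (hb' : ¬ (derivative (p.map PowerSeries.constantCoeff)).IsRoot b) :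
    ∃ r : K⟦X⟧, p.IsRoot r ∧ PowerSeries.constantCoeff r = b := by
  have h0 : p.eval (PowerSeries.C b) ∈ Ideal.span {(PowerSeries.X : K⟦X⟧)} := by
    rw [Ideal.mem_span_singleton, PowerSeries.X_dvd_iff, constantCoeff_eval_C]
    exact hb
  have h1 : IsUnit ((derivative p).eval (PowerSeries.C b)) := by
    rw [PowerSeries.isUnit_iff_constantCoeff, constantCoeff_eval_C, isUnit_iff_ne_zero,
      ← derivative_map]
    exact hb'
  obtain ⟨r, hr, hrb⟩ := HenselianRing.is_henselian p hp (PowerSeries.C b) h0 (h1.map _)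
  rw [Ideal.mem_span_singleton, PowerSeries.X_dvd_iff, map_sub, PowerSeries.constantCoeff_C,
    sub_eq_zero] at hrb
  exact ⟨r, hr, hrb⟩

theorem natDegree_le_ncard_rootSet_diff_add_two {K : Type*} [Field K] [CharZero K] {q : K[X]}
    (hq : q.Splits) (hq0 : q ≠ 0) {a : K}
    (ha : ¬ (derivative (derivative q)).IsRoot a)
    (hsimple : ∀ b ≠ a, q.IsRoot b → ¬ (derivative q).IsRoot b) :
    q.natDegree ≤ (q.rootSet K \ {a}).ncard + 2 := by
  classical
  have h1 : q.rootSet K \ {a} = ((q.roots.toFinset.erase a : Finset K) : Set K) := by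
    ext b
    simp [mem_rootSet_of_ne hq0, and_comm, hq0]
  rw [h1, Set.ncard_coe_finset, hq.natDegree_eq_card_roots, ← Multiset.toFinset_sum_count_eq]
  have ha2 : q.roots.count a ≤ 2 := by
    rw [count_roots]
    by_contra! h
    exact ha (isRoot_iterate_derivative_of_lt_rootMultiplicity (n := 2) h)
  calc _ ≤ ∑ b ∈ insert a (q.roots.toFinset.erase a), q.roots.count b :=
        Finset.sum_le_sum_of_subset fun x hx ↦ by
          by_cases h : x = a
          · simp [h]
          · exact Finset.mem_insert_of_mem (Finset.mem_erase.2 ⟨h, hx⟩)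
    _ = q.roots.count a + ∑ b ∈ q.roots.toFinset.erase a, q.roots.count b :=
        Finset.sum_insert (Finset.notMem_erase _ _)
    _ ≤ 2 + ∑ b ∈ q.roots.toFinset.erase a, 1 := by
        refine add_le_add ha2 (Finset.sum_le_sum fun b hb ↦ ?_)
        rw [Finset.mem_erase, Multiset.mem_toFinset, mem_roots hq0] at hb
        rw [count_roots]
        by_contra! h
        exact hsimple b hb.1 hb.2 ((one_lt_rootMultiplicity_iff_isRoot hq0).1 h).2
    _ = _ := by simp [add_comm]

/-- If `a` is a critical point of the reduction and `p(a)` has a nonzero linear term, then a root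
`r = a + v` with `X ∣ v` is impossible: Taylor expansion gives `p(a) ≡ p(r) = 0` modulo `X ^ 2`. -/
theorem constantCoeff_ne_of_isRoot {K : Type*} [Field K] {p : K⟦X⟧[X]} {a : K}
    (ha' : (derivative (p.map PowerSeries.constantCoeff)).IsRoot a)
    (hlin : PowerSeries.coeff 1 (p.eval (PowerSeries.C a)) ≠ 0) {r : K⟦X⟧} (hr : p.IsRoot r) :
    PowerSeries.constantCoeff r ≠ a := by
  intro hra
  obtain ⟨k, hk⟩ := p.binomExpansion (PowerSeries.C a) (r - PowerSeries.C a)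
  rw [add_sub_cancel, hr.eq_zero] at hk
  have hv : PowerSeries.X ∣ r - PowerSeries.C a := by
    rw [PowerSeries.X_dvd_iff, map_sub, hra]; simp
  have hd : PowerSeries.X ∣ (derivative p).eval (PowerSeries.C a) := by
    rw [PowerSeries.X_dvd_iff, constantCoeff_eval_C, ← derivative_map]
    exact ha'
  have h2 : PowerSeries.X ^ 2 ∣ p.eval (PowerSeries.C a) := by
    have : p.eval (PowerSeries.C a) =
        - ((derivative p).eval (PowerSeries.C a) * (r - PowerSeries.C a) +
          k * (r - PowerSeries.C a) ^ 2) := by linear_combination - hk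
    rw [this, dvd_neg]
    refine dvd_add ?_ ((pow_dvd_pow_of_dvd hv 2).mul_left k)
    rw [pow_two]
    exact mul_dvd_mul hd hv
  exact hlin (PowerSeries.X_pow_dvd_iff.1 h2 1 one_lt_two)

/-- Suppose that the reduction of `p` has a double root `a` and otherwise simple roots, and that
`p(a)` has a nonzero linear term. The simple roots lift to `K((X))`, but `p` does not split there,
so some automorphism over `K((X))` moves a root and moves at most two. -/
theorem exists_galois_moving_two_roots {K : Type*} [Field K] [CharZero K]
    {p : K⟦X⟧[X]} (hp : p.Monic) (hsplit : (p.map PowerSeries.constantCoeff).Splits) {a : K}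
    (ha : (p.map PowerSeries.constantCoeff).IsRoot a)
    (ha' : (derivative (p.map PowerSeries.constantCoeff)).IsRoot a)
    (ha'' : ¬ (derivative (derivative (p.map PowerSeries.constantCoeff))).IsRoot a)
    (hsimple : ∀ b ≠ a, (p.map PowerSeries.constantCoeff).IsRoot b →
      ¬ (derivative (p.map PowerSeries.constantCoeff)).IsRoot b)
    (hlin : PowerSeries.coeff 1 (p.eval (PowerSeries.C a)) ≠ 0) :
    ∃ σ : Gal(AlgebraicClosure K⸨X⸩/K⸨X⸩),
      (∃ ρ ∈ p.rootSet (AlgebraicClosure K⸨X⸩), σ ρ ≠ ρ) ∧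
      {ρ ∈ p.rootSet (AlgebraicClosure K⸨X⸩) | σ ρ ≠ ρ}.ncard ≤ 2 := by
  classical
  set Ω := AlgebraicClosure K⸨X⸩
  have : CharZero K⸨X⸩ := charZero_of_injective_algebraMap (algebraMap K K⸨X⸩).injective
  have : IsGalois K⸨X⸩ Ω := IsAlgClosure.isGalois K⸨X⸩ Ω
  set q := p.map PowerSeries.constantCoeff
  have hqm : q.Monic := hp.map _
  have hinj : Function.Injective (algebraMap K⟦X⟧ Ω) := by
    rw [IsScalarTower.algebraMap_eq K⟦X⟧ K⸨X⸩ Ω]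
    exact (algebraMap K⸨X⸩ Ω).injective.comp (IsFractionRing.injective K⟦X⟧ K⸨X⸩)
  -- If all roots were in `K((X))`, they would be in `K⟦X⟧`, and one of them would reduce to `a`.
  have : ∃ ρ ∈ p.rootSet Ω, ρ ∉ Set.range (algebraMap K⸨X⸩ Ω) := by
    by_contra! hall
    have hΩ : (p.map (algebraMap K⟦X⟧ Ω)).Splits := IsAlgClosed.splits _
    have hspl : p.Splits := by
      refine hΩ.of_splits_map_of_injective hinj fun x hx ↦ ?_
      have hx0 : x ∈ p.rootSet Ω := by
        rw [mem_rootSet', aeval_def, ← eval_map]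
        exact mem_roots'.1 hx
      obtain ⟨y, rfl⟩ := hall x hx0
      have hy : IsIntegral K⟦X⟧ y := by
        refine ⟨p, hp, (algebraMap K⸨X⸩ Ω).injective ?_⟩
        rw [hom_eval₂, map_zero, ← IsScalarTower.algebraMap_eq]
        exact (mem_rootSet_of_injective hinj hp.ne_zero).1 hx0
      obtain ⟨z, rfl⟩ := IsIntegrallyClosed.isIntegral_iff.1 hy
      exact ⟨z, IsScalarTower.algebraMap_apply _ _ _ _⟩
    obtain ⟨r, hr, hra⟩ : ∃ r, p.IsRoot r ∧ PowerSeries.constantCoeff r = a := by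
      have hroots := hspl.roots_map_of_ne_zero (φ := PowerSeries.constantCoeff) hqm.ne_zero
      have : a ∈ q.roots := (mem_roots hqm.ne_zero).2 ha
      rw [hroots, Multiset.mem_map] at this
      obtain ⟨r, hr, hra⟩ := this
      exact ⟨r, (mem_roots hp.ne_zero).1 hr, hra⟩
    exact constantCoeff_ne_of_isRoot ha' hlin hr hra
  obtain ⟨ρ, hρ, hρr⟩ := this
  have : ∃ σ : Gal(Ω/K⸨X⸩), σ ρ ≠ ρ := by
    by_contra! h
    refine hρr ?_
    have := (InfiniteGalois.mem_bot_iff_fixed (k := K⸨X⸩) ρ).2 h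
    exact IntermediateField.mem_bot.1 this
  obtain ⟨σ, hσ⟩ := this
  refine ⟨σ, ⟨ρ, hρ, hσ⟩, ?_⟩
  -- The Hensel lifts of the simple roots are fixed by `σ`; at most two roots are left.
  have hlift (b : K) (hb : b ∈ q.rootSet K \ {a}) :
      ∃ r : K⟦X⟧, p.IsRoot r ∧ PowerSeries.constantCoeff r = b := by
    have hb1 : q.IsRoot b := by simpa [mem_rootSet_of_ne hqm.ne_zero] using hb.1
    exact exists_isRoot_of_simple_root hp hb1 (hsimple b hb.2 hb1)
  choose! r hr hrb using hlift
  have hcard := natDegree_le_ncard_rootSet_diff_add_two hsplit hqm.ne_zero ha'' hsimple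
  have hfin : (q.rootSet K \ {a}).Finite := (rootSet_finite q K).sdiff
  have hrinj : Set.InjOn (algebraMap K⟦X⟧ Ω ∘ r) (q.rootSet K \ {a}) := fun b hb c hc h ↦ by
    rw [← hrb b hb, ← hrb c hc, hinj h]
  have hdisj : Disjoint {ρ ∈ p.rootSet Ω | σ ρ ≠ ρ}
      ((algebraMap K⟦X⟧ Ω ∘ r) '' (q.rootSet K \ {a})) := by
    rw [Set.disjoint_left]
    rintro _ ⟨-, hne⟩ ⟨b, hb, rfl⟩
    refine hne ?_
    rw [Function.comp_apply, IsScalarTower.algebraMap_apply K⟦X⟧ K⸨X⸩ Ω]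
    exact σ.commutes _
  have hsub : {ρ ∈ p.rootSet Ω | σ ρ ≠ ρ} ∪ ((algebraMap K⟦X⟧ Ω ∘ r) '' (q.rootSet K \ {a})) ⊆
      p.rootSet Ω := by
    rintro _ (h | ⟨b, hb, rfl⟩)
    · exact h.1
    · rw [mem_rootSet_of_injective hinj hp.ne_zero, Function.comp_apply,
        aeval_algebraMap_apply, coe_aeval_eq_eval, (hr b hb).eq_zero, map_zero]
  have hle := Set.ncard_le_ncard hsub (rootSet_finite p Ω)
  rw [Set.ncard_union_eq hdisj ((rootSet_finite p Ω).subset fun x hx ↦ hx.1) (hfin.image _),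
    hrinj.ncard_image] at hle
  have hroots : (p.rootSet Ω).ncard ≤ q.natDegree := by
    rw [hp.natDegree_map, rootSet_def, Set.ncard_coe_finset]
    refine (Multiset.toFinset_card_le _).trans ((card_roots' _).trans ?_)
    exact natDegree_map_le
  change {ρ ∈ p.rootSet Ω | σ ρ ≠ ρ}.ncard ≤ 2
  omega

/-! ### Restriction to the splitting field -/

theorem exists_moving_two_roots_restrictNormal {k L Ω : Type*} [Field k] [Field L] [Field Ω]
    [Algebra k L] [Algebra k Ω] [Normal k L] (e : L →ₐ[k] Ω) {f : k[X]}
    (hf : (f.map (algebraMap k L)).Splits) (σ : Gal(Ω/k))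
    (hne : ∃ ρ ∈ f.rootSet Ω, σ ρ ≠ ρ) (hle : {ρ ∈ f.rootSet Ω | σ ρ ≠ ρ}.ncard ≤ 2) :
    ∃ τ : Gal(L/k), (∃ x ∈ f.rootSet L, τ x ≠ x) ∧ {x ∈ f.rootSet L | τ x ≠ x}.ncard ≤ 2 := by
  let := e.toRingHom.toAlgebra
  have : IsScalarTower k L Ω := IsScalarTower.of_algebraMap_eq fun x ↦ (e.commutes x).symm
  have hcomm (x : L) : e (σ.restrictNormal L x) = σ (e x) := σ.restrictNormal_commutes L x
  have hiff (x : L) : σ.restrictNormal L x ≠ x ↔ σ (e x) ≠ e x := by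
    rw [← hcomm]
    exact e.injective.ne_iff.symm
  have himg := hf.image_rootSet e
  refine ⟨σ.restrictNormal L, ?_, ?_⟩
  · obtain ⟨ρ, hρ, hσ⟩ := hne
    rw [← himg] at hρ
    obtain ⟨x, hx, rfl⟩ := hρ
    exact ⟨x, hx, (hiff x).2 hσ⟩
  · refine le_trans ?_ hle
    rw [← Set.ncard_image_of_injective _ e.injective]
    refine Set.ncard_le_ncard ?_ ((rootSet_finite f Ω).subset fun x hx ↦ hx.1)
    rintro _ ⟨x, ⟨hx, hne⟩, rfl⟩
    exact ⟨himg ▸ Set.mem_image_of_mem e hx, (hiff x).1 hne⟩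

theorem exists_moving_two_roots_of_map {k L E Ω : Type*} [Field k] [Field L] [Field E] [Field Ω]
    [Algebra k L] [Algebra E Ω] [IsAlgClosed Ω] (ι : k →+* E) {f : k[X]}
    [hL : f.IsSplittingField k L] (σ : Gal(Ω/E))
    (hne : ∃ ρ ∈ (f.map ι).rootSet Ω, σ ρ ≠ ρ)
    (hle : {ρ ∈ (f.map ι).rootSet Ω | σ ρ ≠ ρ}.ncard ≤ 2) :
    ∃ τ : Gal(L/k), (∃ x ∈ f.rootSet L, τ x ≠ x) ∧ {x ∈ f.rootSet L | τ x ≠ x}.ncard ≤ 2 := by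
  let := ι.toAlgebra
  let := ((algebraMap E Ω).comp ι).toAlgebra
  have : IsScalarTower k E Ω := IsScalarTower.of_algebraMap_eq fun _ ↦ rfl
  have : Normal k L := Normal.of_isSplittingField f
  have hroots : (f.map ι).rootSet Ω = f.rootSet Ω := by
    rw [rootSet, aroots, Polynomial.map_map]
    rfl
  rw [hroots] at hne hle
  exact exists_moving_two_roots_restrictNormal
    (IsSplittingField.lift L f (IsAlgClosed.splits _)) hL.splits (σ.restrictScalars k) hne hle

/-! ### The transposition -/

/-- The parameter `t` and the double root `a` of `X (X - t) ^ (m + 1) + t`. The derivative is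
`(X - t) ^ m ((m + 2) X - t)`, which forces `t = (m + 2) a`; the last equation says that `a` is a
root. -/
theorem exists_double_root_parameters (K : Type*) [Field K] [CharZero K] [IsAlgClosed K] (m : ℕ) :
    ∃ a t : K, t = (m + 2) * a ∧ a ≠ 0 ∧ (a - t) ^ (m + 1) = - (m + 2) := by
  obtain ⟨c, hc⟩ := IsAlgClosed.exists_pow_nat_eq (-(m + 2) : K) m.succ_pos
  have h1 : (m + 1 : K) ≠ 0 := by exact_mod_cast m.succ_ne_zero
  have h2 : (m + 2 : K) ≠ 0 := by exact_mod_cast (m + 1).succ_ne_zero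
  have hc0 : c ≠ 0 := by
    rintro rfl
    rw [zero_pow m.succ_ne_zero, eq_comm, neg_eq_zero] at hc
    exact h2 hc
  refine ⟨- c / (m + 1), _, rfl, div_ne_zero (neg_ne_zero.2 hc0) h1, ?_⟩
  rw [← hc]
  congr 1
  field_simp
  ring

theorem derivative_X_mul_X_sub_C_pow_add_C {K : Type*} [Field K] (m : ℕ) (t : K) :
    derivative (X * (X - C t) ^ (m + 1) + C t) =
      (X - C t) ^ m * (((m : K[X]) + 2) * X - C t) := by
  simp only [derivative_add, derivative_mul, derivative_X, derivative_C, derivative_X_sub_C_pow]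
  push_cast
  simp
  ring

theorem exists_galois_moving_two_roots_specialization (K : Type*) [Field K] [CharZero K]
    [IsAlgClosed K] (m : ℕ) :
    ∃ (t : K) (σ : Gal(AlgebraicClosure K⸨X⸩/K⸨X⸩)),
      let p : K⟦X⟧[X] := X * (X - C (PowerSeries.X + PowerSeries.C t)) ^ (m + 1) +
        C (PowerSeries.X + PowerSeries.C t)
      (∃ ρ ∈ p.rootSet (AlgebraicClosure K⸨X⸩), σ ρ ≠ ρ) ∧
      {ρ ∈ p.rootSet (AlgebraicClosure K⸨X⸩) | σ ρ ≠ ρ}.ncard ≤ 2 := by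
  obtain ⟨a, t, ht, ha0, hpow⟩ := exists_double_root_parameters K m
  have h1 : (m + 1 : K) ≠ 0 := by exact_mod_cast m.succ_ne_zero
  have h2 : (m + 2 : K) ≠ 0 := by exact_mod_cast (m + 1).succ_ne_zero
  have ht0 : t ≠ 0 := ht ▸ mul_ne_zero h2 ha0
  have hat : a - t = - ((m + 1) * a) := by rw [ht]; ring
  refine ⟨t, ?_⟩
  set p : K⟦X⟧[X] := X * (X - C (PowerSeries.X + PowerSeries.C t)) ^ (m + 1) +
    C (PowerSeries.X + PowerSeries.C t) with hp
  have hq : p.map PowerSeries.constantCoeff = X * (X - C t) ^ (m + 1) + C t := by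
    simp [hp]
  refine exists_galois_moving_two_roots (p := p) (a := a)
    (monic_X_mul_X_sub_C_pow_add_C (n := m + 2) (by omega) _)
    (IsAlgClosed.splits _) ?_ ?_ ?_ ?_ ?_
  · rw [hq, IsRoot.def]
    simp [hpow]
    linear_combination ht
  · rw [hq, derivative_X_mul_X_sub_C_pow_add_C, IsRoot.def]
    simp [ht]
  · rw [hq, derivative_X_mul_X_sub_C_pow_add_C, IsRoot.def, derivative_mul]
    have : ((m : K) + 2) * a - t = 0 := by rw [ht, sub_self]
    simp [this, h2, hat, h1, ha0]
  · intro b hb hroot hroot'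
    rw [hq, IsRoot.def] at hroot
    rw [hq, derivative_X_mul_X_sub_C_pow_add_C, IsRoot.def] at hroot'
    simp at hroot hroot'
    rcases hroot' with ⟨h, -⟩ | h
    · rw [h] at hroot; simp [ht0] at hroot
    · exact hb (mul_left_cancel₀ h2 (by linear_combination h + ht))
  · have : p.eval (PowerSeries.C a) =
        PowerSeries.C a * (PowerSeries.C (a - t) - PowerSeries.X) ^ (m + 1) +
          (PowerSeries.X + PowerSeries.C t) := by
      simp [hp, sub_sub, add_comm]
    rw [this, map_add, PowerSeries.coeff_C_mul, PowerSeries.coeff_one_pow]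
    simp
    have hm : a * ((m + 1) * (a - t) ^ m) = (m + 2 : K) := by
      rw [← neg_neg (m + 2 : K), ← hpow, pow_succ, hat]; ring
    intro h
    apply h1
    linear_combination - h - hm

theorem exists_injective_ringHom_powerSeries {F K : Type*} [Field F] [Field K] (i : F →+* K)
    (t : K) : ∃ φ : F[X] →+* K⟦X⟧,
      Function.Injective φ ∧ φ X = PowerSeries.X + PowerSeries.C t := by
  refine ⟨(coeToPowerSeries.ringHom (R := K)).comp
    ((taylorAlgHom t : K[X] →+* K[X]).comp (mapRingHom i)), ?_, by simp⟩
  have h1 : Function.Injective (coeToPowerSeries.ringHom (R := K)) := coe_injective K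
  have h2 : Function.Injective (taylorAlgHom t : K[X] →+* K[X]) := taylor_injective t
  have h3 : Function.Injective (mapRingHom i) := map_injective i i.injective
  exact h1.comp (h2.comp h3)

theorem exists_ringHom_comp_algebraMap {A E : Type*} [Field A] [Field E] (ψ : A[X] →+* E)
    (hψ : Function.Injective ψ) : ∃ ι : RatFunc A →+* E, ι.comp (algebraMap A[X] (RatFunc A)) = ψ :=
  ⟨IsFractionRing.lift hψ, RingHom.ext fun q ↦ IsFractionRing.lift_algebraMap hψ q⟩

/-- The embedding of `F(t)` in `K((x))` with `t ↦ x + t₀` exists and carries the family to the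
expected polynomial. -/
theorem exists_ringHom_laurentSeries {F K : Type*} [Field F] [Field K] (i : F →+* K)
    (t : K) (n : ℕ) : ∃ ι : RatFunc F →+* K⸨X⸩, (familyPoly F n).map ι =
      (X * (X - C (PowerSeries.X + PowerSeries.C t)) ^ (n - 1) +
        C (PowerSeries.X + PowerSeries.C t) : K⟦X⟧[X]).map (algebraMap K⟦X⟧ K⸨X⸩) := by
  obtain ⟨φ, hφ, hφX⟩ := exists_injective_ringHom_powerSeries i t
  obtain ⟨ι, hι⟩ := exists_ringHom_comp_algebraMap ((algebraMap K⟦X⟧ K⸨X⸩).comp φ)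
    ((IsFractionRing.injective K⟦X⟧ K⸨X⸩).comp hφ)
  refine ⟨ι, ?_⟩
  rw [← map_algebraMap_integralFamily, Polynomial.map_map, hι, ← Polynomial.map_map,
    map_integralFamily, hφX]

theorem exists_moving_two_roots {F : Type*} [Field F] [CharZero F] {n : ℕ} (hn : 2 ≤ n)
    {L : Type*} [Field L] [Algebra (RatFunc F) L]
    [hL : (familyPoly F n).IsSplittingField (RatFunc F) L] :
    ∃ τ : Gal(L/RatFunc F), (∃ x ∈ (familyPoly F n).rootSet L, τ x ≠ x) ∧
      {x ∈ (familyPoly F n).rootSet L | τ x ≠ x}.ncard ≤ 2 := by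
  obtain ⟨m, rfl⟩ := Nat.exists_eq_add_of_le' hn
  obtain ⟨t, σ, hne, hle⟩ := exists_galois_moving_two_roots_specialization (AlgebraicClosure F) m
  obtain ⟨ι, hι⟩ := exists_ringHom_laurentSeries (algebraMap F (AlgebraicClosure F)) t (m + 2)
  have hroots : ((familyPoly F (m + 2)).map ι).rootSet
      (AlgebraicClosure (AlgebraicClosure F)⸨X⸩) =
      (X * (X - C (PowerSeries.X + PowerSeries.C t)) ^ (m + 1) +
        C (PowerSeries.X + PowerSeries.C t) : (AlgebraicClosure F)⟦X⟧[X]).rootSet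
          (AlgebraicClosure (AlgebraicClosure F)⸨X⸩) := by
    rw [hι, rootSet, aroots, Polynomial.map_map, ← IsScalarTower.algebraMap_eq]
    rfl
  rw [← hroots] at hne hle
  exact exists_moving_two_roots_of_map ι σ hne hle

/-! ### The Galois group -/

theorem toPermHom_injective_of_isSplittingField {k : Type*} (L : Type*) [Field k] [Field L]
    [Algebra k L] (f : k[X])
    [hL : f.IsSplittingField k L] :
    Function.Injective (MulAction.toPermHom Gal(L/k) (f.rootSet L)) := by
  refine (injective_iff_map_eq_one _).2 fun σ hσ ↦ ?_
  have h : (σ : L →ₐ[k] L) = AlgHom.id k L := by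
    refine AlgHom.ext_of_adjoin_eq_top (IsSplittingField.adjoin_rootSet L f) fun x hx ↦ ?_
    exact congrArg Subtype.val (Equiv.congr_fun hσ ⟨x, hx⟩)
  exact AlgEquiv.ext fun x ↦ DFunLike.congr_fun h x

theorem isSwap_toPermHom {k L : Type*} [Field k] [Field L] [Algebra k L] {f : k[X]}
    [DecidableEq (f.rootSet L)] {τ : Gal(L/k)}
    (hne : ∃ x ∈ f.rootSet L, τ x ≠ x) (hle : {x ∈ f.rootSet L | τ x ≠ x}.ncard ≤ 2) :
    (MulAction.toPermHom Gal(L/k) (f.rootSet L) τ).IsSwap := by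
  rw [← Equiv.Perm.card_support_eq_two]
  refine le_antisymm ?_ (Equiv.Perm.two_le_card_support_of_ne_one ?_)
  · rw [← Set.ncard_coe_finset, ← Set.ncard_image_of_injective _ Subtype.val_injective]
    refine (Set.ncard_le_ncard ?_ ((rootSet_finite f L).subset fun x hx ↦ hx.1)).trans hle
    rintro _ ⟨x, hx, rfl⟩
    refine ⟨x.2, fun h ↦ ?_⟩
    exact Equiv.Perm.mem_support.1 hx (Subtype.ext h)
  · obtain ⟨x, hx, hτ⟩ := hne
    exact fun h ↦ hτ (congrArg Subtype.val (Equiv.congr_fun h ⟨x, hx⟩))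

/-- Jordan's theorem applied to the image of the Galois group. -/
theorem toPermHom_surjective {F : Type*} [Field F] [CharZero F] {n : ℕ} (hn : 2 ≤ n)
    (L : Type*) [Field L] [Algebra (RatFunc F) L]
    [hL : (familyPoly F n).IsSplittingField (RatFunc F) L] :
    Function.Surjective (MulAction.toPermHom Gal(L/RatFunc F) ((familyPoly F n).rootSet L)) := by
  classical
  have : Normal (RatFunc F) L := Normal.of_isSplittingField (familyPoly F n)
  obtain ⟨τ, hne, hle⟩ := exists_moving_two_roots (F := F) hn (L := L)
  have h2 := MulAction.isPreprimitive_of_is_two_pretransitive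
    (isMultiplyPretransitive_two_rootSet (F := F) hn (L := L))
  rw [← MonoidHom.range_eq_top]
  refine Equiv.Perm.subgroup_eq_top_of_isPreprimitive_of_isSwap_mem ?_ _
    (isSwap_toPermHom hne hle) ⟨τ, rfl⟩
  exact MulAction.IsPreprimitive.of_surjective (M := Gal(L/RatFunc F))
    (φ := (MulAction.toPermHom _ _).rangeRestrict) (f := ⟨id, fun _ _ ↦ rfl⟩) Function.surjective_id

theorem lemma4p1 {F : Type*} [Field F] [CharZero F] (n : ℕ) (hn : 1 ≤ n)
    {L : Type*} [Field L] [Algebra (RatFunc F) L]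
    (hL : (familyPoly F n).IsSplittingField (RatFunc F) L) :
    IsSymmetricExtension n (RatFunc F) L := by
  have : CharZero (RatFunc F) :=
    charZero_of_injective_algebraMap (algebraMap F (RatFunc F)).injective
  have hsep : (familyPoly F n).Separable := (irreducible_familyPoly F hn).separable
  refine ⟨IsGalois.of_separable_splitting_field hsep, ?_⟩
  have hcard : Fintype.card ((familyPoly F n).rootSet L) = n := by
    rw [card_rootSet_eq_natDegree hsep hL.splits]
    exact natDegree_X_mul_X_sub_C_pow_add_C hn _
  have hsurj : Function.Surjective
      (MulAction.toPermHom Gal(L/RatFunc F) ((familyPoly F n).rootSet L)) := by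
    rcases hn.eq_or_lt with rfl | hn2
    · have : Subsingleton ((familyPoly F 1).rootSet L) :=
        Fintype.card_le_one_iff_subsingleton.1 hcard.le
      exact Function.surjective_to_subsingleton _
    · exact toPermHom_surjective hn2 L
  exact ⟨(MulEquiv.ofBijective _ ⟨toPermHom_injective_of_isSplittingField L _, hsurj⟩).trans
    (Fintype.equivFinOfCardEq hcard).permCongrHom⟩
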